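/- Let $\mathsf K$ be a nonempty free simplicial $\mathbb Z_2$-complex, i.e. a (possibly infinite) abstract simplicial complex with vertex set $V(\mathsf K)\neq\varnothing$, together with a simplicial map $\nu:\mathsf K\to\mathsf K$ such that $\nu\circ\nu=\mathrm{id}$ and no simplex satisfies $\nu(\sigma)=\sigma$. Let $\operatorname{ind}(\mathsf K)$ be the least integer $d\ge 0$ for which there is a continuous map $f:\|\mathsf K\|\to\mathcal S^d$ with $f(\nu(x))=-f(x)$ for all $x$, where $\|\mathsf K\|$ is the geometric realization of $\mathsf K$ (with the weak topology) and $\nu$ acts on it by affine extension. Let $m$ be a nonnegative integer and let $\lambda:V(\mathsf K)\to\{\pm1,\ldots,\pm m\}$ be a labeling that is antipodal, i.e. $\lambda(\nu(v))=-\lambda(v)$ for every vertex $v$, and has no complementary edges, i.e. $\lambda(u)+\lambda(v)\ne0$ for every pair $uv$ of adjacent vertices of $\mathsf K$. Then $\operatorname{ind}(\mathsf K)$ is finite and, with $d=\operatorname{ind}(\mathsf K)$, the complex $\mathsf K$ contains at least one alternating simplex of dimension $d$, i.e. a simplex $\sigma$ with exactly $d+1$ vertices whose set of labels $\lambda(V(\sigma))$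 is of the form $\{-j_1,+j_2,\ldots,(-1)^{d+1}j_{d+1}\}$ or of the form $\{+j_1,-j_2,\ldots,(-1)^{d}j_{d+1}\}$ for some integers $1\le j_1<\cdots<j_{d+1}$. -/

import Mathlib

/-- A `ℤ₂`-action on a topological space: a homeomorphism `ν` with `ν ∘ ν = id`. -/
structure Z2Action (X : Type*) [TopologicalSpace X] where
  /-- the homeomorphism `ν` -/
  homeo : X ≃ₜ X
  involutive : ∀ x, homeo (homeo x) = x

/-- There is a `ℤ₂`-map, i.e. an equivariant continuous map, from `(X, ν)` to `(Y, ω)`. -/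
def HasZ2Map {X Y : Type*} [TopologicalSpace X] [TopologicalSpace Y]
    (ν : Z2Action X) (ω : Z2Action Y) : Prop :=
  ∃ f : X → Y, Continuous f ∧ ∀ x, f (ν.homeo x) = ω.homeo (f x)

/-- The antipodal action on the unit sphere `S^d` of `ℝ^(d+1)`. -/
noncomputable def sphereAntipodal (d : ℕ) :
    Z2Action (Metric.sphere (0 : EuclideanSpace ℝ (Fin (d + 1))) 1) where
  homeo := Homeomorph.neg _
  involutive x := neg_neg x

/-- The `ℤ₂`-index of a `ℤ₂`-space: the least `d ≥ 0` for which there is a `ℤ₂`-map to `S^d`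
(and `⊤` if there is no such `d`). -/
noncomputable def Z2Action.index {X : Type*} [TopologicalSpace X] (ν : Z2Action X) : ℕ∞ :=
  ⨅ (d : ℕ) (_ : HasZ2Map ν (sphereAntipodal d)), (d : ℕ∞)

namespace AbstractSimplicialComplex

variable {V : Type*}

/-- The underlying space `‖K‖`, in barycentric coordinates: finitely supported families of
nonnegative weights with sum one whose support is a simplex of `K`. -/
def Realization (K : AbstractSimplicialComplex V) : Type _ :=
  {x : V →₀ ℝ // (∀ v, 0 ≤ x v) ∧ (x.sum fun _ a => a) = 1 ∧ x.support ∈ K.faces}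

/-- The closed geometric simplex of `‖K‖` spanned by the vertices in `s`. -/
def ClosedSimplex (K : AbstractSimplicialComplex V) (s : Finset V) : Type _ :=
  {x : K.Realization // x.1.support ⊆ s}

/-- A closed simplex carries the Euclidean topology of its barycentric coordinates. -/
instance (K : AbstractSimplicialComplex V) (s : Finset V) : TopologicalSpace (K.ClosedSimplex s) :=
  TopologicalSpace.induced (fun (x : K.ClosedSimplex s) (v : V) => x.1.1 v) inferInstance

/-- `‖K‖` carries the weak topology: a set is open if and only if its trace on each closed simplex
is open. (For a finite complex this is the topology of the barycentric coordinates.) -/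
instance (K : AbstractSimplicialComplex V) : TopologicalSpace K.Realization :=
  ⨆ s : K.faces, TopologicalSpace.coinduced
    (fun x : K.ClosedSimplex s.1 => (x.1 : K.Realization)) inferInstance

theorem continuous_realization_iff (K : AbstractSimplicialComplex V) {Y : Type*}
    [TopologicalSpace Y] (f : K.Realization → Y) :
    Continuous f ↔ ∀ s ∈ K.faces, Continuous fun x : K.ClosedSimplex s => f x.1 := by
  rw [continuous_iSup_dom]
  simp only [continuous_coinduced_dom, Subtype.forall]
  rfl

theorem continuous_closedSimplex_val (K : AbstractSimplicialComplex V) {s : Finset V}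
    (hs : s ∈ K.faces) : Continuous fun x : K.ClosedSimplex s => (x.1 : K.Realization) :=
  (K.continuous_realization_iff id).1 continuous_id s hs

end AbstractSimplicialComplex

/-- A simplicial `ℤ₂`-complex with vertex set `V`: an abstract simplicial complex with a simplicial
map `ν` to itself such that `ν ∘ ν = id`. -/
structure SimplicialZ2Complex (V : Type*) extends AbstractSimplicialComplex V where
  /-- the action `ν` on the vertices -/
  act : Equiv.Perm V
  act_act : ∀ v, act (act v) = v
  map_mem : ∀ s ∈ faces, s.map act.toEmbedding ∈ faces

namespace SimplicialZ2Complex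

variable {V : Type*}

/-- The action is free if no simplex is fixed. -/
def IsFree (K : SimplicialZ2Complex V) : Prop :=
  ∀ s ∈ K.faces, s.map K.act.toEmbedding ≠ s

/-- The affine extension of the action to `‖K‖`: the weight of `v` becomes the weight of `ν v`. -/
noncomputable def realAct (K : SimplicialZ2Complex V)
    (x : K.toAbstractSimplicialComplex.Realization) : K.toAbstractSimplicialComplex.Realization :=
  ⟨x.1.equivMapDomain K.act, by
    intro v
    rw [Finsupp.equivMapDomain_apply]
    exact x.2.1 _, by
    rw [Finsupp.equivMapDomain_eq_mapDomain, Finsupp.sum_mapDomain_index (by simp) (by simp)]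
    exact x.2.2.1, K.map_mem _ x.2.2.2⟩

theorem act_symm (K : SimplicialZ2Complex V) (v : V) : K.act.symm v = K.act v := by
  rw [Equiv.symm_apply_eq, K.act_act]

theorem realAct_apply (K : SimplicialZ2Complex V)
    (x : K.toAbstractSimplicialComplex.Realization) (v : V) :
    (K.realAct x).1 v = x.1 (K.act v) := by
  rw [← K.act_symm]
  exact Finsupp.equivMapDomain_apply _ _ _

theorem realAct_realAct (K : SimplicialZ2Complex V)
    (x : K.toAbstractSimplicialComplex.Realization) : K.realAct (K.realAct x) = x := by
  apply Subtype.ext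
  ext v
  rw [realAct_apply, realAct_apply, K.act_act]

theorem continuous_realAct (K : SimplicialZ2Complex V) : Continuous K.realAct := by
  rw [AbstractSimplicialComplex.continuous_realization_iff]
  intro s hs
  let g : K.toAbstractSimplicialComplex.ClosedSimplex s →
      K.toAbstractSimplicialComplex.ClosedSimplex (s.map K.act.toEmbedding) :=
    fun x => ⟨K.realAct x.1, Finset.map_subset_map.2 x.2⟩
  have hg : Continuous g := by
    refine continuous_induced_rng.2 (continuous_pi fun v => ?_)
    have h : Continuous fun x : K.toAbstractSimplicialComplex.ClosedSimplex s =>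
        x.1.1 (K.act v) := (continuous_apply (K.act v)).comp continuous_induced_dom
    exact h.congr fun x => (K.realAct_apply x.1 v).symm
  exact (K.toAbstractSimplicialComplex.continuous_closedSimplex_val (K.map_mem s hs)).comp hg

/-- The `ℤ₂`-space `‖K‖`. -/
noncomputable def realZ2Action (K : SimplicialZ2Complex V) :
    Z2Action K.toAbstractSimplicialComplex.Realization where
  homeo :=
    { toFun := K.realAct
      invFun := K.realAct
      left_inv := K.realAct_realAct
      right_inv := K.realAct_realAct
      continuous_toFun := K.continuous_realAct
      continuous_invFun := K.continuous_realAct }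
  involutive := K.realAct_realAct

/-- The `ℤ₂`-index `ind(K) = ind(‖K‖)`. -/
noncomputable def index (K : SimplicialZ2Complex V) : ℕ∞ := K.realZ2Action.index

end SimplicialZ2Complex

/-- A simplex `s` with `d + 1` vertices is negative-alternating if its set of labels is
`{-j₁, +j₂, …, (-1)^(d+1) j_(d+1)}` for some `1 ≤ j₁ < ⋯ < j_(d+1)` (here indexed from `0`). -/
def IsNegAlternating {V : Type*} (lab : V → ℤ) (s : Finset V) : Prop :=
  ∃ j : Fin s.card → ℤ, (∀ i, 1 ≤ j i) ∧ StrictMono j ∧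
    lab '' (s : Set V) = Set.range fun i : Fin s.card => (-1) ^ (i.val + 1) * j i

/-- The same with the signs interchanged: the set of labels is `{+j₁, -j₂, …}`. -/
def IsPosAlternating {V : Type*} (lab : V → ℤ) (s : Finset V) : Prop :=
  ∃ j : Fin s.card → ℤ, (∀ i, 1 ≤ j i) ∧ StrictMono j ∧
    lab '' (s : Set V) = Set.range fun i : Fin s.card => (-1) ^ i.val * j i

/-- A simplex is alternating if it is negative-alternating or positive-alternating. -/
def IsAlternating {V : Type*} (lab : V → ℤ) (s : Finset V) : Prop :=
  IsNegAlternating lab s ∨ IsPosAlternating lab s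

/-! Send each vertex to its label times a point of the moment curve in `ℝ ^ D`, and extend affinely.
The map is odd because the labels are. If no simplex with `D + 1` vertices alternates, it has no
zero: the labels on a simplex, ordered by absolute value, change sign fewer than `D` times, so some
polynomial of degree less than `D` has the sign of each label at its absolute value
(`exists_alternating_sequence_and_polynomial`). Its coefficients define a linear functional that is
positive on the image of the simplex. Normalizing gives a `ℤ₂`-map to the sphere of dimension `D -
1`. For `D` equal to a positive index this contradicts minimality. -/

open Polynomial in
/-- A finite set `A` of nonzero integers without complementary pairs contains an alternating
sequence of some length `n + 1`, such that a polynomial of degree at most `n` has at each `|a|`,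
for `a ∈ A`, the sign of `a`. -/
theorem exists_alternating_sequence_and_polynomial (A : Finset ℤ) (h0 : ∀ a ∈ A, a ≠ 0)
    (hc : ∀ a ∈ A, -a ∉ A) (hA : A.Nonempty) :
    ∃ (n : ℕ) (j : ℕ → ℤ) (ε : ℤ) (p : ℝ[X]), (ε = 1 ∨ ε = -1) ∧ (∀ i ≤ n, 1 ≤ j i) ∧
      (∀ i < n, j i < j (i + 1)) ∧ (∀ i ≤ n, ε * (-1) ^ i * j i ∈ A) ∧ p.natDegree ≤ n ∧
      (∀ a ∈ A, 0 < (a : ℝ) * p.eval ((|a| : ℤ) : ℝ)) ∧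
      ∀ t : ℝ, (∀ a ∈ A, ((|a| : ℤ) : ℝ) ≤ t) → 0 < ((ε * (-1) ^ n : ℤ) : ℝ) * p.eval t := by
  -- Labels are added in order of absolute value. The sign of `p` beyond all of them is carried
  -- along, to compare with the sign of the next label.
  induction A using Finset.induction_on_max_value (fun a : ℤ => |a|) with
  | empty => simp at hA
  | insert a A ha hmax ih =>
    have hane : a ≠ 0 := h0 a (Finset.mem_insert_self _ _)
    have hsign : ∃ δ : ℤ, (δ = 1 ∨ δ = -1) ∧ a = δ * |a| := by
      rcases lt_or_gt_of_ne hane with h | h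
      · exact ⟨-1, Or.inr rfl, by rw [abs_of_neg h]; ring⟩
      · exact ⟨1, Or.inl rfl, by rw [abs_of_pos h]; ring⟩
    obtain ⟨δ, hδ, haδ⟩ := hsign
    have ha1 : 1 ≤ |a| := Int.one_le_abs hane
    have ha1' : (1 : ℝ) ≤ ((|a| : ℤ) : ℝ) := by exact_mod_cast ha1
    have hδδ : (δ : ℝ) * δ = 1 := by rcases hδ with rfl | rfl <;> norm_num
    rcases A.eq_empty_or_nonempty with rfl | hne
    · refine ⟨0, fun _ => |a|, δ, C (δ : ℝ), hδ, fun _ _ => ha1, by simp, ?_, by simp, ?_, ?_⟩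
      · intro i hi
        obtain rfl : i = 0 := by omega
        simp [← haδ]
      · intro b hb
        obtain rfl : b = a := by simpa using hb
        rw [eval_C]
        have : (b : ℝ) = δ * ((|b| : ℤ) : ℝ) := by exact_mod_cast haδ
        rw [this]
        nlinarith
      · intro t _
        rw [eval_C]
        push_cast
        nlinarith
    obtain ⟨n, j, ε, p, hε, hj1, hjm, hjA, hdeg, hp, hpt⟩ :=
      ih (fun b hb => h0 b (Finset.mem_insert_of_mem hb))
        (fun b hb hb' => hc b (Finset.mem_insert_of_mem hb) (Finset.mem_insert_of_mem hb')) hne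
    have hlt : ∀ b ∈ A, |b| < |a| := by
      intro b hb
      refine lt_of_le_of_ne (hmax b hb) fun h => ?_
      rcases abs_eq_abs.1 h with rfl | rfl
      · exact ha hb
      · exact hc a (Finset.mem_insert_self _ _) (Finset.mem_insert_of_mem hb)
    have haR : (a : ℝ) = δ * ((|a| : ℤ) : ℝ) := by exact_mod_cast haδ
    have hu : (ε * (-1) ^ n = δ) ∨ (ε * (-1) ^ n = -δ) := by
      rcases neg_one_pow_eq_or ℤ n with h | h <;> rcases hε with rfl | rfl <;>
        rcases hδ with rfl | rfl <;> simp [h]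
    -- If `p` already has the sign `δ` of `a` at `|a|`, nothing changes. Otherwise the alternating
    -- sequence grows by `a`, and `p` gains a root.
    rcases hu with hu | hu
    · refine ⟨n, j, ε, p, hε, hj1, hjm, fun i hi => Finset.mem_insert_of_mem (hjA i hi), hdeg,
        ?_, fun t ht => hpt t fun b hb => ht b (Finset.mem_insert_of_mem hb)⟩
      intro b hb
      rcases Finset.mem_insert.1 hb with rfl | hb
      · have h := hpt ((|b| : ℤ) : ℝ) fun c hcA => by exact_mod_cast hmax c hcA
        rw [hu] at h
        rw [haR]
        nlinarith
      · exact hp b hb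
    -- The new root `|a| - 1/2` separates `|a|` from the earlier absolute values, which are integers
    -- at most `|a| - 1`. The new factor is positive at those and negative from `|a|` on.
    · have hq : ∀ t : ℝ, (p * (C ((|a| : ℤ) - 1 / 2 : ℝ) - X)).eval t =
          p.eval t * (((|a| : ℤ) : ℝ) - 1 / 2 - t) := by
        intro t
        simp
      refine ⟨n + 1, fun i => if i ≤ n then j i else |a|, ε,
        p * (C ((|a| : ℤ) - 1 / 2 : ℝ) - X), hε, ?_, ?_, ?_, ?_, ?_, ?_⟩
      · intro i _
        dsimp only
        split_ifs with h
        exacts [hj1 i h, ha1]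
      · intro i hi
        dsimp only
        rw [if_pos (by omega)]
        split_ifs with h
        · exact hjm i (by omega)
        · obtain rfl : i = n := by omega
          have h1 := hlt _ (hjA i le_rfl)
          rw [hu, abs_mul, abs_of_pos (by have := hj1 i le_rfl; omega : 0 < j i)] at h1
          rcases hδ with rfl | rfl <;> simpa using h1
      · intro i hi
        dsimp only
        split_ifs with h
        · exact Finset.mem_insert_of_mem (hjA i h)
        · obtain rfl : i = n + 1 := by omega
          rw [pow_succ, ← mul_assoc, hu]
          rw [show -δ * -1 * |a| = a by linarith]
          exact Finset.mem_insert_self _ _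
      · refine natDegree_mul_le.trans (Nat.add_le_add hdeg ?_)
        exact (natDegree_sub_le _ _).trans (by simp)
      · intro b hb
        rw [hq]
        rcases Finset.mem_insert.1 hb with rfl | hb
        · have h := hpt ((|b| : ℤ) : ℝ) fun c hcA => by exact_mod_cast hmax c hcA
          rw [hu] at h
          push_cast at h
          rw [haR]
          push_cast at ha1' ⊢
          nlinarith
        · have h : ((|b| : ℤ) : ℝ) + 1 ≤ ((|a| : ℤ) : ℝ) := by exact_mod_cast hlt b hb
          rw [← mul_assoc]
          exact mul_pos (hp b hb) (by linarith)
      · intro t ht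
        have h := hpt t fun b hb => ht b (Finset.mem_insert_of_mem hb)
        have hat := ht a (Finset.mem_insert_self _ _)
        rw [hq, pow_succ, ← mul_assoc]
        push_cast at h hat ⊢
        nlinarith

/-- The moment-curve map: vertex `v` is sent to `lab v • (1, |lab v|, |lab v|², …)` in `ℝ ^ D`,
and the map is extended linearly. -/
noncomputable def momentMap {V : Type*} (lab : V → ℤ) (D : ℕ) (x : V →₀ ℝ) :
    EuclideanSpace ℝ (Fin D) :=
  WithLp.toLp 2 fun i => x.sum fun v a => a * ((lab v : ℝ) * ((|lab v| : ℤ) : ℝ) ^ i.val)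

/-- Pairing the moment-curve map with the coefficients of a polynomial. -/
theorem sum_coeff_mul_momentMap {V : Type*} (lab : V → ℤ) (D : ℕ) (x : V →₀ ℝ)
    (p : Polynomial ℝ) (hp : p.natDegree < D) :
    ∑ i : Fin D, p.coeff i * momentMap lab D x i =
      ∑ v ∈ x.support, x v * ((lab v : ℝ) * p.eval ((|lab v| : ℤ) : ℝ)) := by
  simp only [momentMap, Finsupp.sum, Finset.mul_sum]
  rw [Finset.sum_comm]
  refine Finset.sum_congr rfl fun v _ => ?_
  rw [Polynomial.eval_eq_sum_range' hp, Finset.mul_sum, Finset.mul_sum, Finset.sum_range]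
  exact Finset.sum_congr rfl fun i _ => by ring

/-- An alternating sequence of labels of vertices of `s` yields an alternating subset of `s`. -/
theorem exists_subset_isAlternating {V : Type*} [DecidableEq V] {lab : V → ℤ} {s : Finset V}
    {n : ℕ} {j : ℕ → ℤ} {ε : ℤ} (hε : ε = 1 ∨ ε = -1) (hj : ∀ i ≤ n, 1 ≤ j i)
    (hmono : ∀ i < n, j i < j (i + 1)) (hmem : ∀ i ≤ n, ε * (-1) ^ i * j i ∈ s.image lab) :
    ∃ t ⊆ s, t.card = n + 1 ∧ IsAlternating lab t := by
  have h1 : ∀ i : Fin (n + 1), ∃ v ∈ s, lab v = ε * (-1) ^ i.val * j i := fun i =>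
    Finset.mem_image.1 (hmem i (Nat.lt_succ_iff.1 i.2))
  choose v hvs hv using h1
  have hsm : StrictMono fun i : Fin (n + 1) => j i :=
    Fin.strictMono_iff_lt_succ.2 fun i => hmono i i.2
  -- The label of `v i` determines `j i`, so the chosen vertices are distinct.
  have habs : ∀ i, |lab (v i)| = j i := by
    intro i
    have h := hj i (Nat.lt_succ_iff.1 i.2)
    rw [hv, abs_mul, abs_mul, abs_neg_one_pow, abs_of_pos (by omega : 0 < j i)]
    rcases hε with rfl | rfl <;> simp
  have hinj : Function.Injective v := fun a b hab => hsm.injective <| by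
    rw [← habs, ← habs, hab]
  refine ⟨Finset.univ.image v, fun w hw => ?_, ?_, ?_⟩
  · obtain ⟨i, -, rfl⟩ := Finset.mem_image.1 hw
    exact hvs i
  · rw [Finset.card_image_of_injective _ hinj, Finset.card_fin]
  have hcard : (Finset.univ.image v).card = n + 1 := by
    rw [Finset.card_image_of_injective _ hinj, Finset.card_fin]
  have himage : lab '' ((Finset.univ.image v : Finset V) : Set V) =
      Set.range fun i : Fin (n + 1) => ε * (-1) ^ i.val * j i := by
    rw [Finset.coe_image, Finset.coe_univ, Set.image_univ, ← Set.range_comp]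
    exact congrArg Set.range (funext hv)
  generalize Finset.univ.image v = t at hcard himage
  unfold IsAlternating IsNegAlternating IsPosAlternating
  rw [hcard, himage]
  rcases hε with rfl | rfl
  · refine Or.inr ⟨fun i => j i, fun i => hj i (Nat.lt_succ_iff.1 i.2), hsm, ?_⟩
    simp
  · refine Or.inl ⟨fun i => j i, fun i => hj i (Nat.lt_succ_iff.1 i.2), hsm, ?_⟩
    exact congrArg Set.range (funext fun i => by rw [pow_succ]; ring)

/-! ### The moment-curve map on the realization -/

namespace SimplicialZ2Complex

variable {V : Type*}

theorem momentMap_realAct (K : SimplicialZ2Complex V) {lab : V → ℤ}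
    (hantipodal : ∀ v, lab (K.act v) = -lab v) (D : ℕ)
    (x : K.toAbstractSimplicialComplex.Realization) :
    momentMap lab D (K.realAct x).1 = -momentMap lab D x.1 := by
  ext i
  simp only [momentMap, realAct, PiLp.neg_apply]
  rw [Finsupp.equivMapDomain_eq_mapDomain,
    Finsupp.sum_mapDomain_index (by simp) (by intros; ring), Finsupp.sum, Finsupp.sum,
    ← Finset.sum_neg_distrib]
  refine Finset.sum_congr rfl fun v _ => ?_
  rw [hantipodal, abs_neg]
  push_cast
  ring

theorem continuous_momentMap (K : AbstractSimplicialComplex V) (lab : V → ℤ) (D : ℕ) :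
    Continuous fun x : K.Realization => momentMap lab D x.1 := by
  rw [K.continuous_realization_iff]
  intro s _
  refine (PiLp.continuous_toLp 2 _).comp (continuous_pi fun i => ?_)
  -- On a closed simplex, the sum over the varying support becomes a sum over the fixed finite set
  -- `s`.
  have h : Continuous fun x : K.ClosedSimplex s =>
      ∑ v ∈ s, x.1.1 v * ((lab v : ℝ) * ((|lab v| : ℤ) : ℝ) ^ i.val) :=
    continuous_finsetSum _ fun v _ =>
      (((continuous_apply v).comp continuous_induced_dom :
        Continuous fun x : K.ClosedSimplex s => x.1.1 v)).mul continuous_const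
  exact h.congr fun x => (Finsupp.sum_of_support_subset x.1.1 x.2
    (fun v a => a * ((lab v : ℝ) * ((|lab v| : ℤ) : ℝ) ^ i.val)) fun _ _ => zero_mul _).symm

/-- The labels on the support of `x` contain no complementary pair, since such a pair would span an
edge. The resulting polynomial pairs with the image of `x` to a sum of positive terms. -/
theorem momentMap_ne_zero [DecidableEq V] (K : AbstractSimplicialComplex V) {lab : V → ℤ}
    (hne : ∀ v, lab v ≠ 0)
    (hedges : ∀ u v : V, u ≠ v → ({u, v} : Finset V) ∈ K.faces → lab u + lab v ≠ 0)
    {D : ℕ} (hD : ¬ ∃ s ∈ K.faces, s.card = D + 1 ∧ IsAlternating lab s)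
    (x : K.Realization) : momentMap lab D x.1 ≠ 0 := by
  have hface := x.2.2.2
  have hnonempty : x.1.support.Nonempty := (K.isRelLowerSet_faces hface).1
  obtain ⟨n, j, ε, p, hε, hj1, hjm, hjA, hdeg, hp, -⟩ :=
    exists_alternating_sequence_and_polynomial (x.1.support.image lab)
      (by simp only [Finset.mem_image]; rintro _ ⟨v, -, rfl⟩; exact hne v)
      (by
        simp only [Finset.mem_image]
        rintro _ ⟨v, hv, rfl⟩ ⟨u, hu, huv⟩
        have huv' : u ≠ v := by
          rintro rfl
          have := hne u
          omega
        refine hedges u v huv' ((K.isRelLowerSet_faces hface).2 ?_ (by simp)) (by omega)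
        exact Finset.insert_subset hu (Finset.singleton_subset_iff.2 hv))
      (hnonempty.image lab)
  -- Otherwise the first `D + 1` terms of the sequence would give an alternating face.
  have hn : n < D := by
    by_contra! h
    obtain ⟨t, hts, htc, ht⟩ := exists_subset_isAlternating hε
      (fun i hi => hj1 i (hi.trans h)) (fun i hi => hjm i (hi.trans_le h))
      (fun i hi => hjA i (hi.trans h))
    exact hD ⟨t, (K.isRelLowerSet_faces hface).2 hts (Finset.card_pos.1 (by omega)), htc, ht⟩
  intro h0
  have hsum := sum_coeff_mul_momentMap lab D x.1 p (hdeg.trans_lt hn)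
  rw [h0] at hsum
  have hpos : 0 < ∑ v ∈ x.1.support, x.1 v * ((lab v : ℝ) * p.eval ((|lab v| : ℤ) : ℝ)) :=
    Finset.sum_pos (fun v hv => mul_pos
      (lt_of_le_of_ne (x.2.1 v) (Finsupp.mem_support_iff.1 hv).symm)
      (hp _ (Finset.mem_image_of_mem lab hv))) hnonempty
  rw [← hsum] at hpos
  simp at hpos

/-- If no simplex with `d + 2` vertices is alternating, the normalized moment-curve map is a
`ℤ₂`-map to `S^d`. -/
theorem hasZ2Map_of_not_exists_isAlternating [DecidableEq V] (K : SimplicialZ2Complex V)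
    {lab : V → ℤ} (hne : ∀ v, lab v ≠ 0) (hantipodal : ∀ v, lab (K.act v) = -lab v)
    (hedges : ∀ u v : V, u ≠ v → ({u, v} : Finset V) ∈ K.faces → lab u + lab v ≠ 0)
    {d : ℕ} (hd : ¬ ∃ s ∈ K.faces, s.card = d + 1 + 1 ∧ IsAlternating lab s) :
    HasZ2Map K.realZ2Action (sphereAntipodal d) := by
  have h0 := momentMap_ne_zero K.toAbstractSimplicialComplex hne hedges hd
  have hcont := continuous_momentMap K.toAbstractSimplicialComplex lab (d + 1)
  refine ⟨fun x => ⟨‖momentMap lab (d + 1) x.1‖⁻¹ • momentMap lab (d + 1) x.1, ?_⟩, ?_, ?_⟩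
  · rw [mem_sphere_zero_iff_norm, norm_smul, norm_inv, norm_norm,
      inv_mul_cancel₀ (norm_ne_zero_iff.2 (h0 x))]
  · exact ((hcont.norm.inv₀ fun x => norm_ne_zero_iff.2 (h0 x)).smul hcont).subtype_mk _
  · intro x
    apply Subtype.ext
    change ‖momentMap lab (d + 1) (K.realAct x).1‖⁻¹ • momentMap lab (d + 1) (K.realAct x).1 =
      -(‖momentMap lab (d + 1) x.1‖⁻¹ • momentMap lab (d + 1) x.1)
    rw [K.momentMap_realAct hantipodal, norm_neg, smul_neg]

end SimplicialZ2Complex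

/-! ### The index and the conclusion -/

theorem Z2Action.index_eq_of_hasZ2Map {X : Type*} [TopologicalSpace X] {ν : Z2Action X} {d : ℕ}
    (h : HasZ2Map ν (sphereAntipodal d))
    (hmin : ∀ e < d, ¬ HasZ2Map ν (sphereAntipodal e)) : ν.index = d := by
  refine le_antisymm (iInf₂_le d h) (le_iInf₂ fun e he => ?_)
  exact_mod_cast not_lt.1 fun hlt => hmin e hlt he

/-- An alternating simplex has at most `m` vertices if the labels are at most `m` in absolute
value. -/
theorem IsAlternating.card_le {V : Type*} {lab : V → ℤ} {m : ℕ} (hm : ∀ v, |lab v| ≤ (m : ℤ))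
    {s : Finset V} (hs : IsAlternating lab s) : s.card ≤ m := by
  have key : ∀ (j : Fin s.card → ℤ) (σ : Fin s.card → ℤ), (∀ i, |σ i| = 1) → (∀ i, 1 ≤ j i) →
      StrictMono j → lab '' (s : Set V) = Set.range (fun i => σ i * j i) → s.card ≤ m := by
    intro j σ hσ hj hmono h
    have hmem : ∀ i ∈ (Finset.univ : Finset (Fin s.card)), j i ∈ Finset.Icc (1 : ℤ) m := by
      intro i _
      obtain ⟨v, -, hv⟩ : σ i * j i ∈ lab '' (s : Set V) := h ▸ ⟨i, rfl⟩
      have hvm := hm v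
      rw [hv, abs_mul, hσ, one_mul] at hvm
      exact Finset.mem_Icc.2 ⟨hj i, (le_abs_self _).trans hvm⟩
    simpa using Finset.card_le_card_of_injOn j hmem hmono.injective.injOn
  rcases hs with ⟨j, hj, hmono, h⟩ | ⟨j, hj, hmono, h⟩
  · exact key j (fun i => (-1) ^ (i.val + 1)) (fun i => abs_neg_one_pow _) hj hmono h
  · exact key j (fun i => (-1) ^ i.val) (fun i => abs_neg_one_pow _) hj hmono h

theorem mainTheorem8 {V : Type*} [DecidableEq V] [Nonempty V] (K : SimplicialZ2Complex V)
    (hfree : K.IsFree) (m : ℕ) (lab : V → ℤ)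
    (hrange : ∀ v, 1 ≤ |lab v| ∧ |lab v| ≤ (m : ℤ))
    (hantipodal : ∀ v, lab (K.act v) = -lab v)
    (hedges : ∀ u v : V, u ≠ v → ({u, v} : Finset V) ∈ K.faces → lab u + lab v ≠ 0) :
    ∃ d : ℕ, K.index = (d : ℕ∞) ∧ ∃ s ∈ K.faces, s.card = d + 1 ∧ IsAlternating lab s := by
  have hne : ∀ v, lab v ≠ 0 := fun v => abs_pos.1 (by have := (hrange v).1; omega)
  have hfin : ∃ d, HasZ2Map K.realZ2Action (sphereAntipodal d) := by
    -- An alternating simplex has at most `m` vertices, hence never `m + 2`.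
    refine ⟨m, K.hasZ2Map_of_not_exists_isAlternating hne hantipodal hedges ?_⟩
    rintro ⟨s, -, hcard, hs⟩
    have := hs.card_le fun v => (hrange v).2
    omega
  classical
  refine ⟨Nat.find hfin, Z2Action.index_eq_of_hasZ2Map (Nat.find_spec hfin)
    fun e he => Nat.find_min hfin he, ?_⟩
  -- Index `0` leaves no smaller sphere to contradict, but any single vertex alternates. For index
  -- `e + 1`, the absence of an alternating simplex with `e + 2` vertices would give a `ℤ₂`-map to
  -- `S^e`.
  rcases hd : Nat.find hfin with _ | e
  · obtain ⟨v⟩ := ‹Nonempty V›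
    have hsign : ∃ ε : ℤ, (ε = 1 ∨ ε = -1) ∧ ε * |lab v| = lab v := by
      rcases abs_choice (lab v) with h | h
      · exact ⟨1, Or.inl rfl, by rw [h, one_mul]⟩
      · exact ⟨-1, Or.inr rfl, by rw [h]; ring⟩
    obtain ⟨ε, hε, hlab⟩ := hsign
    obtain ⟨t, ht, htc, halt⟩ := exists_subset_isAlternating (lab := lab) (s := {v}) (n := 0)
      (j := fun _ => |lab v|) hε (fun _ _ => (hrange v).1) (by simp) (by
        intro i hi
        obtain rfl : i = 0 := by omega
        simp [hlab])
    exact ⟨t, (K.isRelLowerSet_faces (K.singleton_mem v)).2 ht (Finset.card_pos.1 (by omega)),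
      htc, halt⟩
  · by_contra h
    exact Nat.find_min hfin (m := e) (by omega)
      (K.hasZ2Map_of_not_exists_isAlternating hne hantipodal hedges h)
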